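/- Let $m,n\ge 1$ be integers, $\zeta_m=e^{2\pi i/m}$ and $\mu_m=\{\zeta\in\mathbb C:\zeta^m=1\}$. For a positive integer $p\mid m$, let $G(m,p,n)$ be the group of $n\times n$ complex matrices with exactly one nonzero entry in each row and column, whose nonzero entries $\zeta_1,\dots,\zeta_n$ lie in $\mu_m$ and satisfy $(\zeta_1\cdots\zeta_n)^{m/p}=1$. For a group $G$ of invertible $n\times n$ complex matrices, let $\mathcal A_G$ be the set of hyperplanes that are fixed spaces of pseudoreflections of $G$ (elements of finite order whose fixed space is a hyperplane), let $L(G)$ be the set of all intersections of members of $\mathcal A_G$ (including the empty intersection $\mathbb C^n$) ordered by reverse inclusion, and, for $k\ge0$, let $S(G,k)$ be the number of elements of rank $n-k$ in $L(G)$, where $x$ has rank $r$ if all maximal chains from the least element $\mathbb C^n$ to $x$ have length $r$. Write $i^c=\zeta_m^c\mathbf e_i\in\mathbb C^n$ and $[n^m]=\{0\}\uplus\{i^c : 1\le i\le n,\ 0\le c<m\}$. Distinct subsets $T_1,\dots,T_m$ of $[n^m]$ form an $m$-tuple if for all $a,b$ there is $\zeta\in\mu_m$ with $T_a=\zeta T_b$.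 A colored set partition of type $(m,n)$ is a set partition $S_0/S_1/\dots/S_{km}$ of $[n^m]$, for some $k\ge 0$, such that (i) $0\in S_0$, and if $i^c\in S_0$ for some $c$ then $i^d\in S_0$ for all $0\le d<m$; and (ii) $S_{lm+1},\dots,S_{(l+1)m}$ form an $m$-tuple for each $0\le l<k$. It is of type $\overline{(m,n)}$ if moreover (iii) $S_0\ne\{0,i^0,i^1,\dots,i^{m-1}\}$ for every $i$. Let $\Pi_{m,n}$ and $\overline\Pi_{m,n}$ be the posets of partitions of type $(m,n)$ and $\overline{(m,n)}$ respectively, ordered by refinement, and let $S(m,n,k)$ and $\overline S(m,n,k)$ be the numbers of their elements with $km+1$ blocks. **Theorem.** (a) If $p$ is a positive integer with $p\mid m$ and $p<m$, then $L(G(m,p,n))\cong\Pi_{m,n}$ as posets, and $S(G(m,p,n),k)=S(m,n,k)$ for all $k\ge0$. (b) Unless $m=1$ and $n\ge2$, $L(G(m,m,n))\cong\overline\Pi_{m,n}$ as posets, and $S(G(m,m,n),k)=\overline S(m,n,k)$ for all $k\ge0$. -/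

import Mathlib

open scoped MatrixGroups -- the notation `GL`

noncomputable section

/-! ### Rank and Whitney numbers of the second kind -/

/-- `x` has rank `r` in the poset `P`: there is a saturated chain
`0̂ = x₀ ⋖ x₁ ⋖ ⋯ ⋖ x_l = x` from a least element of `P` to `x`, and every such chain has
length `r`. (In a finite poset with `0̂` the saturated chains from `0̂` to `x` are the maximal
chains from `0̂` to `x`.) -/
def HasRank {P : Type*} [PartialOrder P] (x : P) (r : ℕ) : Prop :=
  (∃ s : RelSeries {(a, b) : P × P | a ⋖ b}, IsBot s.head ∧ s.last = x) ∧
    ∀ s : RelSeries {(a, b) : P × P | a ⋖ b}, IsBot s.head → s.last = x → s.length = r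

/-- The Whitney number of the second kind `W(P, r) = #{x ∈ P | rk x = r}`, for `r ∈ ℤ`. -/
def whitneySecond (P : Type*) [PartialOrder P] (r : ℤ) : ℕ :=
  Nat.card {x : P // ∃ d : ℕ, (d : ℤ) = r ∧ HasRank x d}

/-! ### Arrangements, intersection lattices, and Stirling numbers of linear groups -/

/-- The set of all subspaces of `ℂⁿ` that are intersections of members of `A`
(the empty intersection being `ℂⁿ`), ordered by reverse inclusion. -/
abbrev IntersectionLattice {n : ℕ} (A : Set (Submodule ℂ (Fin n → ℂ))) : Type :=
  {W : Submodule ℂ (Fin n → ℂ) // ∃ B ⊆ A, W = sInf B}ᵒᵈ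

/-- The fixed space `{v ∈ ℂⁿ | g v = v}`. -/
def fixedSpace {n : ℕ} (g : GL (Fin n) ℂ) : Submodule ℂ (Fin n → ℂ) :=
  (Matrix.toLin' (g : Matrix (Fin n) (Fin n) ℂ)).fixedSubmodule

/-- A pseudoreflection: of finite order, and its fixed points form a hyperplane. -/
def IsPseudoreflection {n : ℕ} (g : GL (Fin n) ℂ) : Prop :=
  IsOfFinOrder g ∧ Module.finrank ℂ (fixedSpace g) + 1 = n

/-- The set `A_G` of hyperplanes of the pseudoreflections in `G`. -/
def reflectionArrangement {n : ℕ} (G : Subgroup (GL (Fin n) ℂ)) :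
    Set (Submodule ℂ (Fin n → ℂ)) :=
  {H | ∃ g ∈ G, IsPseudoreflection g ∧ H = fixedSpace g}

/-- The intersection lattice `L(G) = L(A_G)`. -/
abbrev ReflectionLattice {n : ℕ} (G : Subgroup (GL (Fin n) ℂ)) : Type :=
  IntersectionLattice (reflectionArrangement G)

/-- The Stirling number of the second kind `S(G, k) = W(L(A_G), n - k)`. -/
def stirlingSecondGroup {n : ℕ} (G : Subgroup (GL (Fin n) ℂ)) (k : ℕ) : ℕ :=
  whitneySecond (ReflectionLattice G) ((n : ℤ) - (k : ℤ))

/-! ### The groups `G(m, p, n)` -/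

/-- `A` has exactly one nonzero entry in every row and column (that of row `i` is `ζ i`, in
column `σ i`), these entries are `m`-th roots of unity, and `(ζ₁ ⋯ ζₙ)^(m/p) = 1`. -/
def IsGmpn (m p n : ℕ) (A : Matrix (Fin n) (Fin n) ℂ) : Prop :=
  ∃ (σ : Equiv.Perm (Fin n)) (ζ : Fin n → ℂˣ),
    (∀ i, ζ i ^ m = 1) ∧ (∏ i, ζ i) ^ (m / p) = 1 ∧
      ∀ i j, A i j = if σ i = j then (ζ i : ℂ) else 0

theorem IsGmpn.one (m p n : ℕ) : IsGmpn m p n 1 :=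
  ⟨1, fun _ => 1, by simp, by simp, fun i j => by
    by_cases h : i = j
    · subst h
      simp
    · simp [h]⟩

theorem IsGmpn.mul {m p n : ℕ} {A B : Matrix (Fin n) (Fin n) ℂ}
    (hA : IsGmpn m p n A) (hB : IsGmpn m p n B) : IsGmpn m p n (A * B) := by
  obtain ⟨σ, ζ, h1, h2, h3⟩ := hA
  obtain ⟨τ, η, k1, k2, k3⟩ := hB
  refine ⟨τ * σ, fun i => ζ i * η (σ i), fun i => by rw [mul_pow, h1, k1, one_mul], ?_, ?_⟩
  · rw [Finset.prod_mul_distrib, Equiv.prod_comp σ η, mul_pow, h2, k2, one_mul]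
  · intro i j
    rw [Matrix.mul_apply, Finset.sum_eq_single (σ i)]
    · by_cases h : τ (σ i) = j <;> simp [h3, k3, h]
    · intro x _ hx
      simp [h3, hx.symm]
    · simp

theorem IsGmpn.inv {m p n : ℕ} {g : GL (Fin n) ℂ} (hg : IsGmpn m p n (g : Matrix _ _ ℂ)) :
    IsGmpn m p n ((g⁻¹ : GL (Fin n) ℂ) : Matrix _ _ ℂ) := by
  obtain ⟨σ, ζ, h1, h2, h3⟩ := hg
  refine ⟨σ⁻¹, fun i => (ζ (σ⁻¹ i))⁻¹, fun i => by rw [inv_pow, h1, inv_one], ?_, ?_⟩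
  · rw [Finset.prod_inv_distrib, Equiv.prod_comp σ⁻¹ ζ, inv_pow, h2, inv_one]
  · let B : Matrix (Fin n) (Fin n) ℂ :=
      fun i j => if σ⁻¹ i = j then (((ζ (σ⁻¹ i))⁻¹ : ℂˣ) : ℂ) else 0
    have hB : (g : Matrix (Fin n) (Fin n) ℂ) * B = 1 := by
      ext i j
      rw [Matrix.mul_apply, Finset.sum_eq_single (σ i)]
      · by_cases h : i = j
        · subst h
          rw [h3, if_pos rfl, Matrix.one_apply_eq]
          simp [B]
        · rw [Matrix.one_apply_ne h]
          simp [B, h]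
      · intro x _ hx
        rw [h3, if_neg hx.symm, zero_mul]
      · simp
    have hinv : ((g⁻¹ : GL (Fin n) ℂ) : Matrix (Fin n) (Fin n) ℂ) = B := by
      rw [← mul_one ((g⁻¹ : GL (Fin n) ℂ) : Matrix (Fin n) (Fin n) ℂ), ← hB, ← mul_assoc,
        Units.inv_mul, one_mul]
    intro i j
    rw [hinv]

/-- The group `G(m, p, n)` of matrices, for positive integers `m, p, n` with `p ∣ m`. -/
def groupG (m p n : ℕ) : Subgroup (GL (Fin n) ℂ) where
  carrier := {g | IsGmpn m p n (g : Matrix (Fin n) (Fin n) ℂ)}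
  mul_mem' ha hb := IsGmpn.mul ha hb
  one_mem' := IsGmpn.one m p n
  inv_mem' hg := IsGmpn.inv hg

/-! ### Colored set partitions -/

/-- The base `i` with color `c`: `i^c = ζ_m^c e_i`, where `ζ_m = exp(2πi/m)`. -/
def colored (m : ℕ) {n : ℕ} (i : Fin n) (c : ℕ) : Fin n → ℂ :=
  Pi.single i (Complex.exp (2 * Real.pi * Complex.I / m) ^ c)

/-- The set `[n^m] = {0} ⊎ {i^c | i ∈ [n], 0 ≤ c < m}`. -/
def coloredSet (m n : ℕ) : Set (Fin n → ℂ) :=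
  {0} ∪ {v | ∃ (i : Fin n) (c : ℕ), c < m ∧ v = colored m i c}

/-- `T` is a multiple of `S`: `T = ζ S` for some `ζ ∈ μ_m`. -/
def IsMultiple (m : ℕ) {n : ℕ} (T S : Set (Fin n → ℂ)) : Prop :=
  ∃ ζ : ℂ, ζ ^ m = 1 ∧ T = (fun v => ζ • v) '' S

/-- Distinct sets `T₁, …, T_m` form an `m`-tuple if any two of them are multiples. -/
def IsMTuple {m n : ℕ} (T : Fin m → Set (Fin n → ℂ)) : Prop :=
  Function.Injective T ∧ ∀ i j, IsMultiple m (T i) (T j)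

/-- The set partition `σ` of `[n^m]` is a colored set partition of type `(m, n)`: its blocks
are, without repetition, a zero block `S₀` and sets `S l j` (`l < k`, `j < m`) such that
`0 ∈ S₀`, and `S₀` contains all colors of a base as soon as it contains one, and, for every
`l`, the sets `S l j` form an `m`-tuple. -/
def IsColoredPartition {m n : ℕ} (σ : Finpartition (coloredSet m n)) : Prop :=
  ∃ (k : ℕ) (S₀ : Set (Fin n → ℂ)) (S : Fin k → Fin m → Set (Fin n → ℂ)),
    Function.Injective (fun q : Fin k × Fin m => S q.1 q.2) ∧ (∀ l j, S l j ≠ S₀) ∧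
    (∀ T, T ∈ σ.parts ↔ T = S₀ ∨ ∃ l j, T = S l j) ∧
    (0 ∈ S₀ ∧ ∀ i : Fin n, (∃ c < m, colored m i c ∈ S₀) → ∀ d < m, colored m i d ∈ S₀) ∧
    (∀ l, IsMTuple (S l))

/-- The additional condition on the zero block: no block of `σ` equals
`{0, i^0, i^1, …, i^(m-1)}` for some `i`. (A block of this form contains `0`, so it can only
be the zero block.) -/
def NoSingleBaseZeroBlock {m n : ℕ} (σ : Finpartition (coloredSet m n)) : Prop :=
  ∀ i : Fin n, {0} ∪ {v | ∃ c < m, v = colored m i c} ∉ σ.parts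

/-- The poset `Π_{m,n}` of type `(m, n)` colored set partitions. The order is Mathlib's order
on `Finpartition`: `σ ≤ τ` iff every block of `σ` is contained in some block of `τ`. -/
abbrev ColoredPartitions (m n : ℕ) : Type :=
  {σ : Finpartition (coloredSet m n) // IsColoredPartition σ}

/-- The poset of colored set partitions of type `\overline{(m, n)}`, ordered by refinement. -/
abbrev ReducedColoredPartitions (m n : ℕ) : Type :=
  {σ : Finpartition (coloredSet m n) // IsColoredPartition σ ∧ NoSingleBaseZeroBlock σ}

/-- `S(m, n, k)`: the number of type `(m, n)` partitions with `km + 1` blocks. -/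
def stirlingSecondColored (m n k : ℕ) : ℕ :=
  Nat.card {σ : ColoredPartitions m n // σ.1.parts.card = k * m + 1}

/-- `\overline{S}(m, n, k)`: the number of type `\overline{(m, n)}` partitions with `km + 1`
blocks. -/
def stirlingSecondReducedColored (m n k : ℕ) : ℕ :=
  Nat.card {σ : ReducedColoredPartitions m n // σ.1.parts.card = k * m + 1}

end

/-! Each element of `[n^m]` is read as a linear form through the dot product. A subspace `W` then
partitions `[n^m]` by equality of restrictions to `W` (`partitionOf`), and a partition `σ` cuts out
the subspace where each block is constant (`partSpace`). These maps are mutually inverse between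
colored partitions and subspaces cut out by equations between elements of `[n^m]` (`IsDotClosed`);
shrinking the subspace coarsens the partition, which matches reverse inclusion with refinement.

The substantial half is that a colored partition is recovered from its subspace. An `m`-tuple is a
free `μ_m`-orbit of blocks `z T`, so some vector takes the value `z` on each `z T` and `0` on all
other blocks (`ColoredData.exists_dual`). These vectors separate the blocks and form a basis of
`partSpace σ`, whence `km + 1` blocks correspond to dimension `k`. Conversely, for any `W` the
coordinates not vanishing on `W`, up to factors in `μ_m`, index the `m`-tuples
(`isColoredPartition_partitionOf`).

It remains to identify the arrangement. The hyperplanes are `x_i = ζ x_j` with `i ≠ j`, together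
with `x_i = 0` exactly when `p < m`. Every equation between elements of `[n^m]` reduces to these
forms, which settles `p < m`. For `p = m`, the equation `x_i = 0` can only arise from `x_i = ζ x_j =
ζ' x_j` with `ζ ≠ ζ'`, so a second coordinate vanishes too: this is the condition on the zero block.
Rank in the lattice is codimension, which gives the counts. -/

noncomputable section

/-! ### Rank in the intersection lattice of a hyperplane arrangement -/

section Rank

variable {n : ℕ} {A : Set (Submodule ℂ (Fin n → ℂ))}

/-- The subspace underlying an element of the intersection lattice. -/
def IntersectionLattice.space (x : IntersectionLattice A) : Submodule ℂ (Fin n → ℂ) :=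
  (OrderDual.ofDual x).1

theorem IntersectionLattice.le_iff {x y : IntersectionLattice A} :
    x ≤ y ↔ y.space ≤ x.space := Iff.rfl

theorem IntersectionLattice.lt_iff {x y : IntersectionLattice A} :
    x < y ↔ y.space < x.space := Iff.rfl

theorem IntersectionLattice.isBot_iff {x : IntersectionLattice A} :
    IsBot x ↔ x.space = ⊤ := by
  constructor
  · intro h
    exact top_le_iff.1 (h (OrderDual.toDual ⟨⊤, ∅, by simp, by simp⟩))
  · intro h y
    rw [IntersectionLattice.le_iff, h]
    exact le_top

theorem finrank_inf_hyperplane {W H : Submodule ℂ (Fin n → ℂ)}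
    (hH : Module.finrank ℂ H + 1 = n) (hW : ¬ W ≤ H) :
    Module.finrank ℂ (W ⊓ H : Submodule ℂ (Fin n → ℂ)) + 1 = Module.finrank ℂ W := by
  have h1 := Submodule.finrank_sup_add_finrank_inf_eq W H
  have h2 : H < W ⊔ H := lt_of_le_of_ne le_sup_right fun h => hW (h ▸ le_sup_left)
  have h3 := Submodule.finrank_lt_finrank_of_lt h2
  have h4 := Submodule.finrank_le (W ⊔ H)
  rw [Module.finrank_fin_fun] at h4
  omega

/-- Some hyperplane `H` defining `y` does not contain `x`. The intersection of `x` with `H` belongs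
to the lattice, lies strictly above `x` and at most at `y`, so the covering relation forces it to be
`y`. -/
theorem IntersectionLattice.finrank_of_covBy (hA : ∀ H ∈ A, Module.finrank ℂ H + 1 = n)
    {x y : IntersectionLattice A} (h : x ⋖ y) :
    Module.finrank ℂ y.space + 1 = Module.finrank ℂ x.space := by
  obtain ⟨Bx, hBx, hx⟩ := (OrderDual.ofDual x).2
  obtain ⟨By, hBy, hy⟩ := (OrderDual.ofDual y).2
  change x.space = _ at hx
  change y.space = _ at hy
  have hlt := IntersectionLattice.lt_iff.1 h.1
  have : ∃ H ∈ By, ¬ x.space ≤ H := by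
    by_contra! hc
    exact hlt.not_ge (hy ▸ le_sInf hc)
  obtain ⟨H, hHB, hH⟩ := this
  let z : IntersectionLattice A := OrderDual.toDual
    ⟨x.space ⊓ H, insert H Bx, Set.insert_subset (hBy hHB) hBx, by
      rw [sInf_insert, hx, inf_comm]⟩
  have hxz : x < z :=
    IntersectionLattice.lt_iff.2 (inf_le_left.lt_of_ne fun e => hH (inf_eq_left.1 e))
  have hzy : z ≤ y := IntersectionLattice.le_iff.2 (le_inf hlt.le (hy ▸ sInf_le hHB))
  have hz : z = y := hzy.eq_of_not_lt (h.2 hxz)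
  rw [← hz]
  exact finrank_inf_hyperplane (hA H (hBy hHB)) hH

theorem IntersectionLattice.length_chain (hA : ∀ H ∈ A, Module.finrank ℂ H + 1 = n)
    (s : RelSeries {(a, b) : IntersectionLattice A × IntersectionLattice A | a ⋖ b})
    (hs : IsBot s.head) : s.length + Module.finrank ℂ s.last.space = n := by
  have key : ∀ i : Fin (s.length + 1), (i : ℕ) + Module.finrank ℂ (s i).space = n := by
    intro i
    induction i using Fin.induction with
    | zero =>
      have : (s 0).space = ⊤ := IntersectionLattice.isBot_iff.1 hs
      rw [this, finrank_top, Module.finrank_fin_fun]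
      simp
    | succ i ih =>
      have := IntersectionLattice.finrank_of_covBy hA (s.step i)
      simp only [Fin.val_castSucc, Fin.val_succ] at ih ⊢
      omega
  exact key (Fin.last _)

theorem IntersectionLattice.exists_chain (x : IntersectionLattice A) :
    ∃ s : RelSeries {(a, b) : IntersectionLattice A × IntersectionLattice A | a ⋖ b},
      IsBot s.head ∧ s.last = x := by
  induction hd : n - Module.finrank ℂ x.space using Nat.strong_induction_on generalizing x with
  | _ d ih =>
  by_cases hx : IsBot x
  · exact ⟨RelSeries.singleton _ x, hx, rfl⟩
  · have hne : {y : IntersectionLattice A | y < x}.Nonempty := by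
      refine ⟨OrderDual.toDual ⟨⊤, ∅, by simp, by simp⟩, ?_⟩
      refine IntersectionLattice.lt_iff.2 (lt_top_iff_ne_top.2 fun h => hx ?_)
      exact IntersectionLattice.isBot_iff.2 h
    -- The order is reversed, so an element below `x` of least dimension is covered by `x`: anything
    -- strictly between would have smaller dimension.
    obtain ⟨z, hz, hmin⟩ := WellFounded.has_min
      (InvImage.wf (fun y : IntersectionLattice A => Module.finrank ℂ y.space) wellFounded_lt)
      _ hne
    have hcov : z ⋖ x := ⟨hz, fun c hzc hcx =>
      hmin c hcx (Submodule.finrank_lt_finrank_of_lt (IntersectionLattice.lt_iff.1 hzc))⟩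
    have h1 := Submodule.finrank_lt_finrank_of_lt (IntersectionLattice.lt_iff.1 hz)
    have h2 := Submodule.finrank_le z.space
    rw [Module.finrank_fin_fun] at h2
    obtain ⟨s, hs, hl⟩ := ih _ (by omega) z rfl
    exact ⟨s.snoc x (by rw [hl]; exact hcov), by simpa using hs, by simp⟩

theorem IntersectionLattice.hasRank_iff (hA : ∀ H ∈ A, Module.finrank ℂ H + 1 = n)
    (x : IntersectionLattice A) (r : ℕ) :
    HasRank x r ↔ r + Module.finrank ℂ x.space = n := by
  constructor
  · rintro ⟨⟨s, hs, rfl⟩, h⟩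
    rw [← h s hs rfl]
    exact IntersectionLattice.length_chain hA s hs
  · refine fun h => ⟨x.exists_chain, ?_⟩
    rintro s hs rfl
    have := IntersectionLattice.length_chain hA s hs
    omega

theorem IntersectionLattice.whitneySecond_eq (hA : ∀ H ∈ A, Module.finrank ℂ H + 1 = n) (k : ℕ) :
    whitneySecond (IntersectionLattice A) ((n : ℤ) - k) =
      Nat.card {x : IntersectionLattice A // Module.finrank ℂ x.space = k} := by
  refine Nat.card_congr (Equiv.subtypeEquivRight fun x => ?_)
  simp only [IntersectionLattice.hasRank_iff hA]
  constructor
  · rintro ⟨d, h1, h2⟩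
    omega
  · intro h
    have h2 := Submodule.finrank_le x.space
    rw [Module.finrank_fin_fun] at h2
    exact ⟨n - k, by omega, by omega⟩

end Rank

/-! ### The reflection arrangement of `G(m, p, n)` -/

section Arrangement

variable {n : ℕ}

/-- The hyperplane `{x | v ⬝ x = w ⬝ x}`. -/
def dotEqLocus (v w : Fin n → ℂ) : Submodule ℂ (Fin n → ℂ) :=
  LinearMap.ker (dotProductBilin ℂ ℂ (v - w))

theorem mem_dotEqLocus {v w x : Fin n → ℂ} : x ∈ dotEqLocus v w ↔ v ⬝ᵥ x = w ⬝ᵥ x := by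
  simp [dotEqLocus, sub_eq_zero]

theorem finrank_dotEqLocus {v w : Fin n → ℂ} (h : v ≠ w) :
    Module.finrank ℂ (dotEqLocus v w) + 1 = n := by
  have : dotProductBilin ℂ ℂ (v - w) ≠ 0 := by
    intro h0
    refine h (sub_eq_zero.1 (funext fun i => ?_))
    simpa using LinearMap.congr_fun h0 (Pi.single i 1)
  have := Module.Dual.finrank_ker_add_one_of_ne_zero this
  rwa [Module.finrank_fin_fun] at this

theorem mem_fixedSpace {g : GL (Fin n) ℂ} {x : Fin n → ℂ} :
    x ∈ fixedSpace g ↔ (g : Matrix (Fin n) (Fin n) ℂ).mulVec x = x := by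
  simp [fixedSpace, LinearMap.mem_fixedSubmodule_iff]

theorem mulVec_of_monomial {B : Matrix (Fin n) (Fin n) ℂ} {σ : Equiv.Perm (Fin n)}
    {ζ : Fin n → ℂˣ} (h : ∀ i j, B i j = if σ i = j then (ζ i : ℂ) else 0)
    (x : Fin n → ℂ) (i : Fin n) : B.mulVec x i = ζ i * x (σ i) := by
  simp [Matrix.mulVec, dotProduct, h]

/-- Both sides have codimension one, so a single nontrivial equation satisfied by all fixed vectors
determines the hyperplane. -/
theorem pseudoreflection_eq_of_le {g : GL (Fin n) ℂ} (hg : IsPseudoreflection g)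
    {v w : Fin n → ℂ} (h : v ≠ w) (hle : fixedSpace g ≤ dotEqLocus v w) :
    fixedSpace g = dotEqLocus v w := by
  refine Submodule.eq_of_le_of_finrank_eq hle ?_
  have := hg.2
  have := finrank_dotEqLocus h
  omega

/-- A pseudoreflection of `G(m, p, n)` fixes a hyperplane `x_i = ζ x_j` or `x_i = 0`. -/
theorem reflectionArrangement_groupG_subset {m p : ℕ} {H : Submodule ℂ (Fin n → ℂ)}
    (hH : H ∈ reflectionArrangement (groupG m p n)) :
    (∃ i j : Fin n, i ≠ j ∧ ∃ z : ℂ, z ^ m = 1 ∧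
      H = dotEqLocus (Pi.single i 1) (Pi.single j z)) ∨
    (m / p ≠ 1 ∧ ∃ i : Fin n, H = dotEqLocus (Pi.single i 1) 0) := by
  obtain ⟨g, ⟨σ, ζ, h1, h2, h3⟩, hg, rfl⟩ := hH
  have hfix : ∀ x ∈ fixedSpace g, ∀ i, ζ i * x (σ i) = x i := fun x hx i => by
    rw [← mulVec_of_monomial h3, mem_fixedSpace.1 hx]
  by_cases hσ : σ = 1
  · subst hσ
    right
    have hz : ∀ i, ζ i ≠ 1 → fixedSpace g = dotEqLocus (Pi.single i 1) 0 := by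
      intro i hi
      refine pseudoreflection_eq_of_le hg (by simp) fun x hx => ?_
      have h := hfix x hx i
      have hi' : (ζ i : ℂ) - 1 ≠ 0 := by
        rw [sub_ne_zero, Ne, Units.val_eq_one]
        exact hi
      have : ((ζ i : ℂ) - 1) * x i = 0 := by
        rw [sub_mul, one_mul, sub_eq_zero]
        exact h
      simpa [mem_dotEqLocus, hi'] using this
    have hex : ∃ i, ζ i ≠ 1 := by
      by_contra! hc
      have : fixedSpace g = ⊤ := by
        refine top_le_iff.1 fun x _ => mem_fixedSpace.2 (funext fun i => ?_)
        rw [mulVec_of_monomial h3, hc i]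
        simp
      have h := hg.2
      rw [this, finrank_top, Module.finrank_fin_fun] at h
      omega
    obtain ⟨i, hi⟩ := hex
    -- For `m / p = 1` the entries have product `1`. Only entry `i` can differ from `1`, since
    -- another such entry `j` would make the fixed space equal to two different coordinate
    -- hyperplanes; hence `ζ i` is the product, that is `1`.
    refine ⟨fun hmp => hi ?_, i, hz i hi⟩
    rw [hmp, pow_one, Finset.prod_eq_single i] at h2
    · exact h2
    · intro j _ hji
      by_contra hj
      have hmem : (Pi.single j 1 : Fin n → ℂ) ∈ dotEqLocus (Pi.single i 1) 0 := by
        rw [mem_dotEqLocus]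
        simp [hji.symm]
      rw [← hz i hi, hz j hj, mem_dotEqLocus] at hmem
      simp at hmem
    · simp
  · left
    obtain ⟨i, hi⟩ : ∃ i, σ i ≠ i := by
      by_contra! hc
      exact hσ (Equiv.ext hc)
    refine ⟨i, σ i, hi.symm, ζ i, by rw [← Units.val_pow_eq_pow_val, h1, Units.val_one], ?_⟩
    refine pseudoreflection_eq_of_le hg ?_ fun x hx => ?_
    · intro h
      have := congrFun h i
      simp [hi.symm] at this
    · rw [mem_dotEqLocus, single_dotProduct, single_dotProduct, one_mul]
      exact (hfix x hx i).symm

theorem mem_reflectionArrangement_of_fixedSpace {G : Subgroup (GL (Fin n) ℂ)} {g : GL (Fin n) ℂ}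
    (hG : g ∈ G) (hg : IsOfFinOrder g) {v w : Fin n → ℂ} (h : v ≠ w)
    (hfix : ∀ x, (g : Matrix (Fin n) (Fin n) ℂ).mulVec x = x ↔ v ⬝ᵥ x = w ⬝ᵥ x) :
    dotEqLocus v w ∈ reflectionArrangement G := by
  have : fixedSpace g = dotEqLocus v w := by
    ext x
    rw [mem_fixedSpace, mem_dotEqLocus, hfix]
  exact ⟨g, hG, ⟨hg, by rw [this, finrank_dotEqLocus h]⟩, this.symm⟩

/-- The hyperplanes `x_i = ζ x_j` belong to the arrangement of `G(m, p, n)`. -/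
theorem dotEqLocus_single_mem_reflectionArrangement (m p : ℕ) (hm : 0 < m) {i j : Fin n}
    (hij : i ≠ j) {z : ℂ} (hz : z ^ m = 1) :
    dotEqLocus (Pi.single i 1) (Pi.single j z) ∈ reflectionArrangement (groupG m p n) := by
  have hz0 : z ≠ 0 := by
    rintro rfl
    simp [hm.ne'] at hz
  let u : ℂˣ := Units.mk0 z hz0
  have hu : u ^ m = 1 := Units.ext (by simpa [u] using hz)
  -- The reflection is the transposition of `i` and `j` with entries `u` and `u⁻¹`. It is an
  -- involution, and its entries have product `1`, so it lies in the group for every `p`.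
  let ζ : Fin n → ℂˣ := Pi.mulSingle i u * Pi.mulSingle j u⁻¹
  let σ : Equiv.Perm (Fin n) := Equiv.swap i j
  have ζi : ζ i = u := by simp [ζ, hij]
  have ζj : ζ j = u⁻¹ := by simp [ζ, hij.symm]
  have ζk : ∀ k, k ≠ i → k ≠ j → ζ k = 1 := fun k h1 h2 => by simp [ζ, h1, h2]
  let B : Matrix (Fin n) (Fin n) ℂ := Matrix.of fun k l => if σ k = l then (ζ k : ℂ) else 0
  have hB : ∀ k l, B k l = if σ k = l then (ζ k : ℂ) else 0 := fun k l => rfl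
  have hζσ : ∀ k, ζ k * ζ (σ k) = 1 := by
    intro k
    by_cases h1 : k = i
    · subst h1
      simp [σ, ζi, ζj]
    by_cases h2 : k = j
    · subst h2
      simp [σ, ζi, ζj]
    · simp [σ, Equiv.swap_apply_of_ne_of_ne h1 h2, ζk k h1 h2]
  have hBB : B * B = 1 := by
    refine Matrix.ext_of_mulVec_single fun k => funext fun l => ?_
    rw [← Matrix.mulVec_mulVec, mulVec_of_monomial hB, mulVec_of_monomial hB, ← mul_assoc,
      ← Units.val_mul, hζσ]
    simp [σ, Pi.single_apply, Matrix.one_apply]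
  let g : GL (Fin n) ℂ := ⟨B, B, hBB, hBB⟩
  have hg : IsGmpn m p n (g : Matrix (Fin n) (Fin n) ℂ) := by
    refine ⟨σ, ζ, fun k => ?_, by simp [ζ, Finset.prod_mul_distrib], hB⟩
    by_cases h1 : k = i
    · rw [h1, ζi, hu]
    by_cases h2 : k = j
    · rw [h2, ζj, inv_pow, hu, inv_one]
    · rw [ζk k h1 h2, one_pow]
  refine mem_reflectionArrangement_of_fixedSpace (g := g) hg ?_ ?_ ?_
  · refine isOfFinOrder_iff_pow_eq_one.2 ⟨2, by simp, Units.ext ?_⟩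
    rw [pow_two]
    exact hBB
  · intro h
    have := congrFun h i
    simp [hij] at this
  · intro x
    rw [single_dotProduct, single_dotProduct, one_mul]
    constructor
    · intro h
      have := congrFun h i
      rw [mulVec_of_monomial hB] at this
      simpa [σ, ζi, u] using this.symm
    · intro h
      funext k
      change B.mulVec x k = x k
      rw [mulVec_of_monomial hB]
      by_cases h1 : k = i
      · subst h1
        simpa [σ, ζi, u] using h.symm
      by_cases h2 : k = j
      · subst h2
        simp [σ, ζj, u, h, hz0]
      · simp [σ, Equiv.swap_apply_of_ne_of_ne h1 h2, ζk k h1 h2]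

/-- The coordinate hyperplanes belong to the arrangement of `G(m, p, n)` if `p < m`. -/
theorem dotEqLocus_zero_mem_reflectionArrangement {m p : ℕ} (hm : 0 < m) (hp : 0 < p)
    (hpm : p ∣ m) (hlt : p < m) (i : Fin n) :
    dotEqLocus (Pi.single i 1) 0 ∈ reflectionArrangement (groupG m p n) := by
  obtain ⟨q, rfl⟩ := hpm
  have hq : 1 < q := by
    by_contra! h
    have := Nat.mul_le_mul_left p h
    omega
  have hprim := Complex.isPrimitiveRoot_exp q (by omega)
  obtain ⟨u, hu⟩ := hprim.isUnit (by omega)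
  rw [← hu] at hprim
  have hu1 : u ^ q = 1 := Units.ext (by simpa using hprim.pow_eq_one)
  have hune : (u : ℂ) - 1 ≠ 0 := sub_ne_zero.2 (hprim.ne_one hq)
  -- The reflection is diagonal with one nontrivial entry, a primitive root of unity of order `q = m
  -- / p > 1`.
  let ζ : Fin n → ℂˣ := Pi.mulSingle i u
  have hζ : ζ ^ q = 1 := by
    simp only [ζ]
    rw [← Pi.mulSingle_pow, hu1, Pi.mulSingle_one]
  let φ : (Fin n → ℂˣ) →* GL (Fin n) ℂ :=
    (Units.map (Matrix.diagonalRingHom (Fin n) ℂ : (Fin n → ℂ) →* Matrix (Fin n) (Fin n) ℂ)).comp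
      (MulEquiv.piUnits (M := fun _ : Fin n => ℂ)).symm.toMonoidHom
  have hB : ∀ k l, (φ ζ : Matrix (Fin n) (Fin n) ℂ) k l =
      if (1 : Equiv.Perm (Fin n)) k = l then (ζ k : ℂ) else 0 := fun k l => rfl
  have hg : IsGmpn (p * q) p n (φ ζ : Matrix (Fin n) (Fin n) ℂ) := by
    refine ⟨1, ζ, fun k => ?_, by simp [ζ, Nat.mul_div_cancel_left q hp, hu1], hB⟩
    have := congrFun hζ k
    simp only [Pi.pow_apply, Pi.one_apply] at this
    rw [mul_comm, pow_mul, this, one_pow]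
  refine mem_reflectionArrangement_of_fixedSpace (g := φ ζ) hg ?_ (by simp) ?_
  · exact φ.isOfFinOrder (isOfFinOrder_iff_pow_eq_one.2 ⟨q, by omega, hζ⟩)
  · intro x
    rw [single_dotProduct, zero_dotProduct, one_mul]
    constructor
    · intro h
      have := congrFun h i
      rw [mulVec_of_monomial hB] at this
      have h2 : ((u : ℂ) - 1) * x i = 0 := by
        rw [sub_mul, one_mul, sub_eq_zero]
        simpa [ζ] using this
      simpa [hune] using h2
    · intro h
      funext k
      rw [mulVec_of_monomial hB]
      by_cases h1 : k = i
      · subst h1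
        simp [h]
      · simp [ζ, h1]

end Arrangement

/-! ### Colored set partitions and the subspaces they define -/

section Partition

variable {m n : ℕ}

theorem mem_coloredSet (hm : 0 < m) {v : Fin n → ℂ} :
    v ∈ coloredSet m n ↔ v = 0 ∨ ∃ i z, z ^ m = 1 ∧ v = Pi.single i z := by
  have hprim := Complex.isPrimitiveRoot_exp m hm.ne'
  refine or_congr Iff.rfl ⟨?_, ?_⟩
  · rintro ⟨i, c, -, rfl⟩
    exact ⟨i, _, by rw [pow_right_comm, hprim.pow_eq_one, one_pow], rfl⟩
  · rintro ⟨i, z, hz, rfl⟩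
    have : NeZero m := ⟨hm.ne'⟩
    obtain ⟨c, hc, rfl⟩ := hprim.eq_pow_of_pow_eq_one hz
    exact ⟨i, c, hc, rfl⟩

theorem zero_mem_coloredSet : (0 : Fin n → ℂ) ∈ coloredSet m n := Or.inl rfl

theorem single_mem_coloredSet (hm : 0 < m) (i : Fin n) {z : ℂ} (hz : z ^ m = 1) :
    (Pi.single i z : Fin n → ℂ) ∈ coloredSet m n :=
  (mem_coloredSet hm).2 (Or.inr ⟨i, z, hz, rfl⟩)

theorem coloredSet_finite (m n : ℕ) : (coloredSet m n).Finite := by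
  refine (Set.finite_singleton _).union
    ((Set.finite_range fun q : Fin n × Fin m => colored m q.1 q.2).subset ?_)
  rintro _ ⟨i, c, hc, rfl⟩
  exact ⟨(i, ⟨c, hc⟩), rfl⟩

theorem smul_mem_coloredSet (hm : 0 < m) {z : ℂ} (hz : z ^ m = 1) {v : Fin n → ℂ}
    (hv : v ∈ coloredSet m n) : z • v ∈ coloredSet m n := by
  rcases (mem_coloredSet hm).1 hv with rfl | ⟨i, u, hu, rfl⟩
  · rwa [smul_zero]
  · rw [← Pi.single_smul, smul_eq_mul]
    exact single_mem_coloredSet hm i (by rw [mul_pow, hz, hu, one_mul])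

theorem ne_zero_of_pow_eq_one (hm : 0 < m) {z : ℂ} (hz : z ^ m = 1) : z ≠ 0 := by
  rintro rfl
  simp [hm.ne'] at hz

theorem Finpartition.eq_part_of_mem {α : Type*} {s : Set α} (σ : Finpartition s) {T U : Set α}
    (hT : T ∈ σ.parts) (hU : U ∈ σ.parts) {v : α} (hvT : v ∈ T) (hvU : v ∈ U) : T = U :=
  σ.disjoint.elim hT hU (Set.not_disjoint_iff.2 ⟨v, hvT, hvU⟩)

theorem Finpartition.exists_part_mem {α : Type*} {s : Set α} (σ : Finpartition s) {v : α}
    (hv : v ∈ s) : ∃ T ∈ σ.parts, v ∈ T := by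
  rw [← σ.sup_parts, Finset.sup_id_set_eq_sUnion] at hv
  exact hv

/-! ### From subspaces to partitions and back -/

/-- The elements of `[n^m]` that agree with `v`, as linear forms, on the subspace `W`. -/
def block (m : ℕ) (W : Submodule ℂ (Fin n → ℂ)) (v : Fin n → ℂ) : Set (Fin n → ℂ) :=
  {w ∈ coloredSet m n | ∀ x ∈ W, w ⬝ᵥ x = v ⬝ᵥ x}

theorem mem_block_self {W : Submodule ℂ (Fin n → ℂ)} {v : Fin n → ℂ} (hv : v ∈ coloredSet m n) :
    v ∈ block m W v := ⟨hv, fun _ _ => rfl⟩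

theorem block_eq_iff {W : Submodule ℂ (Fin n → ℂ)} {v w : Fin n → ℂ} (hv : v ∈ coloredSet m n) :
    block m W v = block m W w ↔ ∀ x ∈ W, v ⬝ᵥ x = w ⬝ᵥ x := by
  constructor
  · intro h
    exact (h ▸ mem_block_self hv : v ∈ block m W w).2
  · intro h
    ext u
    exact and_congr_right fun _ => forall₂_congr fun x hx => by rw [h x hx]

/-- The partition of `[n^m]` by the values of its elements as linear forms on `W`. -/
def partitionOf (m : ℕ) (W : Submodule ℂ (Fin n → ℂ)) : Finpartition (coloredSet m n) where
  parts := ((coloredSet_finite m n).image (block m W)).toFinset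
  supIndep := by
    rw [Finset.supIndep_iff_pairwiseDisjoint, Set.Finite.coe_toFinset]
    rintro _ ⟨v, hv, rfl⟩ _ ⟨w, hw, rfl⟩ hne
    refine Set.disjoint_left.2 fun u hu hu' => hne ?_
    exact (block_eq_iff hv).2 fun x hx => (hu.2 x hx).symm.trans (hu'.2 x hx)
  sup_parts := by
    rw [Finset.sup_id_set_eq_sUnion, Set.Finite.coe_toFinset]
    refine subset_antisymm (Set.sUnion_subset ?_) fun v hv => ?_
    · rintro _ ⟨v, -, rfl⟩
      exact fun w hw => hw.1
    · exact ⟨_, ⟨v, hv, rfl⟩, mem_block_self hv⟩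
  bot_notMem := by
    rw [Set.Finite.mem_toFinset]
    rintro ⟨v, hv, h⟩
    exact (h ▸ mem_block_self hv : v ∈ (⊥ : Set (Fin n → ℂ)))

theorem mem_partitionOf {W : Submodule ℂ (Fin n → ℂ)} {T : Set (Fin n → ℂ)} :
    T ∈ (partitionOf m W).parts ↔ ∃ v ∈ coloredSet m n, block m W v = T := by
  simp [partitionOf]

/-- `W` is cut out by equations between elements of `[n^m]`. -/
def IsDotClosed (m : ℕ) (W : Submodule ℂ (Fin n → ℂ)) : Prop :=
  ∀ y, (∀ v ∈ coloredSet m n, ∀ w ∈ coloredSet m n, (∀ x ∈ W, v ⬝ᵥ x = w ⬝ᵥ x) →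
    v ⬝ᵥ y = w ⬝ᵥ y) → y ∈ W

theorem partitionOf_le_iff {W V : Submodule ℂ (Fin n → ℂ)} (hW : IsDotClosed m W) :
    partitionOf m W ≤ partitionOf m V ↔ V ≤ W := by
  constructor
  · intro h y hy
    refine hW y fun v hv w hw hvw => ?_
    obtain ⟨T, hT, hle⟩ := h (mem_partitionOf.2 ⟨v, hv, rfl⟩)
    obtain ⟨u, hu, rfl⟩ := mem_partitionOf.1 hT
    have h1 := (hle (mem_block_self hv)).2 y hy
    have h2 := (hle (show w ∈ block m W v from ⟨hw, fun x hx => (hvw x hx).symm⟩)).2 y hy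
    exact h1.trans h2.symm
  · rintro h T hT
    obtain ⟨v, hv, rfl⟩ := mem_partitionOf.1 hT
    exact ⟨_, mem_partitionOf.2 ⟨v, hv, rfl⟩, fun w hw => ⟨hw.1, fun x hx => hw.2 x (h hx)⟩⟩

/-- The subspace on which all elements of a block of `σ` agree, for every block. -/
def partSpace (σ : Finpartition (coloredSet m n)) : Submodule ℂ (Fin n → ℂ) where
  carrier := {x | ∀ T ∈ σ.parts, ∀ v ∈ T, ∀ w ∈ T, v ⬝ᵥ x = w ⬝ᵥ x}
  add_mem' ha hb T hT v hv w hw := by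
    rw [dotProduct_add, dotProduct_add, ha T hT v hv w hw, hb T hT v hv w hw]
  zero_mem' T hT v hv w hw := by simp
  smul_mem' c x hx T hT v hv w hw := by
    rw [dotProduct_smul, dotProduct_smul, hx T hT v hv w hw]

theorem isDotClosed_partSpace (σ : Finpartition (coloredSet m n)) :
    IsDotClosed m (partSpace σ) := fun _ hy T hT v hv w hw =>
  hy v (σ.le hT hv) w (σ.le hT hw) fun _ hx => hx T hT v hv w hw

theorem partSpace_partitionOf {W : Submodule ℂ (Fin n → ℂ)} (hW : IsDotClosed m W) :
    partSpace (partitionOf m W) = W := by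
  ext y
  constructor
  · intro hy
    refine hW y fun v hv w hw h => ?_
    exact hy _ (mem_partitionOf.2 ⟨v, hv, rfl⟩) v (mem_block_self hv) w
      ⟨hw, fun x hx => (h x hx).symm⟩
  · rintro hy T hT v hv w hw
    obtain ⟨u, -, rfl⟩ := mem_partitionOf.1 hT
    exact (hv.2 y hy).trans (hw.2 y hy).symm

/-! ### Recovering a colored partition from its subspace -/

/-- A vector dual to the free `μ_m`-orbit of `T`. -/
theorem exists_orbit_dual (hm : 0 < m) {T : Set (Fin n → ℂ)} (hT : T ⊆ coloredSet m n)
    (h0 : 0 ∉ T) (hfree : ∀ z : ℂ, z ^ m = 1 → ∀ v ∈ T, z • v ∈ T → z = 1) :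
    ∃ x : Fin n → ℂ, (∀ z : ℂ, z ^ m = 1 → ∀ v ∈ T, (z • v) ⬝ᵥ x = z) ∧
      ∀ v ∈ coloredSet m n, (∀ z : ℂ, z ^ m = 1 → ∀ w ∈ T, v ≠ z • w) → v ⬝ᵥ x = 0 := by
  classical
  -- By freeness `T` contains at most one color `u` of the base `i`; the coordinate is `u⁻¹` if
  -- there is one and `0` otherwise.
  have hx : ∀ i : Fin n, ∃ c : ℂ, (∀ u : ℂ, u ^ m = 1 → Pi.single i u ∈ T → u * c = 1) ∧
      (c ≠ 0 → ∃ u : ℂ, u ^ m = 1 ∧ Pi.single i u ∈ T) := by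
    intro i
    by_cases h : ∃ u : ℂ, u ^ m = 1 ∧ Pi.single i u ∈ T
    · obtain ⟨u, hu, huT⟩ := h
      have hu0 := ne_zero_of_pow_eq_one hm hu
      refine ⟨u⁻¹, fun u' hu' hu'T => ?_, fun _ => ⟨u, hu, huT⟩⟩
      refine hfree _ (by rw [mul_pow, inv_pow, hu, hu', inv_one, one_mul]) _ huT ?_
      rw [← Pi.single_smul, smul_eq_mul, inv_mul_cancel_right₀ hu0]
      exact hu'T
    · exact ⟨0, fun u hu huT => (h ⟨u, hu, huT⟩).elim, fun h' => (h' rfl).elim⟩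
  choose x hx1 hx2 using hx
  refine ⟨x, fun z hz v hv => ?_, fun v hv h => ?_⟩
  · rcases (mem_coloredSet hm).1 (hT hv) with rfl | ⟨i, u, hu, rfl⟩
    · exact (h0 hv).elim
    · rw [smul_dotProduct, single_dotProduct, hx1 i u hu hv, smul_eq_mul, mul_one]
  · rcases (mem_coloredSet hm).1 hv with rfl | ⟨i, u, hu, rfl⟩
    · rw [zero_dotProduct]
    · rw [single_dotProduct]
      by_contra hne
      obtain ⟨u', hu', hu'T⟩ := hx2 i (right_ne_zero_of_mul hne)
      refine h (u * u'⁻¹) (by rw [mul_pow, inv_pow, hu, hu', inv_one, one_mul]) _ hu'T ?_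
      rw [← Pi.single_smul, smul_eq_mul,
        inv_mul_cancel_right₀ (ne_zero_of_pow_eq_one hm hu')]

/-- The `m` distinct sets are multiples of `S a` by `m` distinct scalars, which by counting exhaust
`μ_m`. Thus an `m`-tuple is a free `μ_m`-orbit. -/
theorem IsMTuple.range_eq (hm : 0 < m) {S : Fin m → Set (Fin n → ℂ)} (hS : IsMTuple S)
    (a : Fin m) : (∀ z : ℂ, z ^ m = 1 → (fun v => z • v) '' S a ∈ Set.range S) ∧
      ∀ z : ℂ, z ^ m = 1 → (fun v => z • v) '' S a = S a → z = 1 := by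
  choose z hz using fun j => hS.2 j a
  have hinj : Function.Injective z := fun i j h => hS.1 (by rw [(hz i).2, (hz j).2, h])
  have hsurj : ∀ u : ℂ, u ^ m = 1 → ∃ j, z j = u := by
    intro u hu
    have hsub : Finset.univ.image z ⊆ Polynomial.nthRootsFinset m (1 : ℂ) := by
      intro w hw
      obtain ⟨j, -, rfl⟩ := Finset.mem_image.1 hw
      exact (Polynomial.mem_nthRootsFinset hm _).2 (hz j).1
    have heq := Finset.eq_of_subset_of_card_le hsub (by
      rw [(Complex.isPrimitiveRoot_exp m hm.ne').card_nthRootsFinset,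
        Finset.card_image_of_injective _ hinj, Finset.card_univ, Fintype.card_fin])
    have : u ∈ Finset.univ.image z := heq ▸ (Polynomial.mem_nthRootsFinset hm _).2 hu
    simpa using this
  refine ⟨fun u hu => ?_, fun u hu h => ?_⟩
  · obtain ⟨j, rfl⟩ := hsurj u hu
    exact ⟨j, (hz j).2⟩
  · obtain ⟨j, rfl⟩ := hsurj u hu
    obtain ⟨b, hb⟩ := hsurj 1 (one_pow m)
    have hj : j = a := hS.1 ((hz j).2.trans h)
    have hba : b = a := hS.1 (by rw [(hz b).2, hb]; simp)
    rw [hj, ← hba, hb]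

/-- A colored partition, described by its zero block and representatives of its `m`-tuples. -/
structure ColoredData (σ : Finpartition (coloredSet m n)) (k : ℕ) (S₀ : Set (Fin n → ℂ))
    (T : Fin k → Set (Fin n → ℂ)) : Prop where
  card_parts : σ.parts.card = k * m + 1
  zeroBlock_mem : S₀ ∈ σ.parts
  zero_mem : 0 ∈ S₀
  zero_notMem : ∀ l, 0 ∉ T l
  image_mem : ∀ l (z : ℂ), z ^ m = 1 → (fun v => z • v) '' T l ∈ σ.parts
  free : ∀ l (z : ℂ), z ^ m = 1 → ∀ v ∈ T l, z • v ∈ T l → z = 1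
  exists_eq : ∀ U ∈ σ.parts, U = S₀ ∨ ∃ l, ∃ z : ℂ, z ^ m = 1 ∧ U = (fun v => z • v) '' T l
  image_eq : ∀ l l' (z z' : ℂ), z ^ m = 1 → z' ^ m = 1 →
    (fun v => z • v) '' T l = (fun v => z' • v) '' T l' → l = l'

theorem IsColoredPartition.exists_data (hm : 0 < m) {σ : Finpartition (coloredSet m n)}
    (hσ : IsColoredPartition σ) : ∃ k S₀ T, ColoredData σ k S₀ T := by
  classical
  obtain ⟨k, S₀, S, hinj, hne, hparts, ⟨h0, -⟩, htup⟩ := hσ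
  let a : Fin m := ⟨0, hm⟩
  have hS₀ : S₀ ∈ σ.parts := (hparts _).2 (Or.inl rfl)
  have hS : ∀ l j, S l j ∈ σ.parts := fun l j => (hparts _).2 (Or.inr ⟨l, j, rfl⟩)
  have himg : ∀ l (z : ℂ), z ^ m = 1 → ∃ j, S l j = (fun v => z • v) '' S l a :=
    fun l z hz => ((htup l).range_eq hm a).1 z hz
  have himg' : ∀ l (z : ℂ), z ^ m = 1 → (fun v => z • v) '' S l a ∈ σ.parts := by
    intro l z hz
    obtain ⟨j, hj⟩ := himg l z hz
    exact hj ▸ hS l j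
  refine ⟨k, S₀, fun l => S l a, ?_, hS₀, h0, ?_, himg', ?_, ?_, ?_⟩
  · have : σ.parts = insert S₀ (Finset.univ.image fun q : Fin k × Fin m => S q.1 q.2) := by
      ext U
      simp [hparts, eq_comm]
    rw [this, Finset.card_insert_of_notMem, Finset.card_image_of_injective _ hinj]
    · simp
    · simp [hne]
  · exact fun l h => hne l a (σ.eq_part_of_mem (hS l a) hS₀ h h0)
  -- If `v` and `z • v` share a block, then this block and its multiple by `z` meet, hence coincide;
  -- freeness on blocks gives `z = 1`.
  · intro l z hz v hv hzv
    exact ((htup l).range_eq hm a).2 z hz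
      (σ.eq_part_of_mem (himg' l z hz) (hS l a) ⟨v, hv, rfl⟩ hzv)
  · intro U hU
    rcases (hparts U).1 hU with h | ⟨l, j, rfl⟩
    · exact Or.inl h
    · exact Or.inr ⟨l, (htup l).2 j a⟩
  · intro l l' z z' hz hz' h
    obtain ⟨j, hj⟩ := himg l z hz
    obtain ⟨j', hj'⟩ := himg l' z' hz'
    have := @hinj (l, j) (l', j') (by simp only [hj, hj', h])
    exact (Prod.ext_iff.1 this).1

namespace ColoredData

variable {σ : Finpartition (coloredSet m n)} {k : ℕ} {S₀ : Set (Fin n → ℂ)}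
  {T : Fin k → Set (Fin n → ℂ)}

theorem mem_parts (h : ColoredData σ k S₀ T) (l : Fin k) : T l ∈ σ.parts := by
  simpa using h.image_mem l 1 (one_pow m)

/-- The vector given by `exists_orbit_dual` for `T l` vanishes on `S₀` and on the orbits of the
other `T l'`, as these parts are disjoint from the orbit of `T l`. It is therefore constant on every
part. -/
theorem exists_dual (hm : 0 < m) (h : ColoredData σ k S₀ T) :
    ∃ x : Fin k → Fin n → ℂ, (∀ l, x l ∈ partSpace σ) ∧ (∀ l, ∀ v ∈ S₀, v ⬝ᵥ x l = 0) ∧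
      (∀ l (z : ℂ), z ^ m = 1 → ∀ v ∈ T l, (z • v) ⬝ᵥ x l = z) ∧
      ∀ l l' (z : ℂ), l ≠ l' → z ^ m = 1 → ∀ v ∈ T l, (z • v) ⬝ᵥ x l' = 0 := by
  choose x hx1 hx2 using fun l =>
    exists_orbit_dual hm (σ.le (h.mem_parts l)) (h.zero_notMem l) (h.free l)
  have h3 : ∀ l, ∀ v ∈ S₀, v ⬝ᵥ x l = 0 := by
    intro l v hv
    refine hx2 l v (σ.le h.zeroBlock_mem hv) fun z hz w hw hvw => ?_
    have heq := σ.eq_part_of_mem h.zeroBlock_mem (h.image_mem l z hz) hv ⟨w, hw, hvw.symm⟩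
    have h0 := h.zero_mem
    rw [heq] at h0
    obtain ⟨u, hu, hu0⟩ := h0
    have : u = 0 := (smul_eq_zero.1 hu0).resolve_left (ne_zero_of_pow_eq_one hm hz)
    exact h.zero_notMem l (this ▸ hu)
  have h4 : ∀ l l' (z : ℂ), l ≠ l' → z ^ m = 1 → ∀ v ∈ T l, (z • v) ⬝ᵥ x l' = 0 := by
    intro l l' z hl hz v hv
    refine hx2 l' _ (smul_mem_coloredSet hm hz (σ.le (h.mem_parts l) hv))
      fun z' hz' w hw hvw => hl ?_
    exact h.image_eq l l' z z' hz hz' (σ.eq_part_of_mem (h.image_mem l z hz)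
      (h.image_mem l' z' hz') ⟨v, hv, rfl⟩ ⟨w, hw, hvw.symm⟩)
  refine ⟨x, fun l U hU v hv w hw => ?_, h3, hx1, h4⟩
  rcases h.exists_eq U hU with rfl | ⟨l', z, hz, rfl⟩
  · rw [h3 l v hv, h3 l w hw]
  · obtain ⟨v, hv, rfl⟩ := hv
    obtain ⟨w, hw, rfl⟩ := hw
    by_cases hl : l' = l
    · subst hl
      simp only [hx1 l' z hz v hv, hx1 l' z hz w hw]
    · simp only [h4 l' l z hl hz v hv, h4 l' l z hl hz w hw]

/-- The dual vectors separate parts: the `l`-th one has the nonzero value `z` on `z T l`, and `0` on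
`S₀` and on the multiples of every other `T l'`. -/
theorem eq_of_agree (hm : 0 < m) (h : ColoredData σ k S₀ T) {U V : Set (Fin n → ℂ)}
    (hU : U ∈ σ.parts) (hV : V ∈ σ.parts) {v w : Fin n → ℂ} (hv : v ∈ U) (hw : w ∈ V)
    (hvw : ∀ x ∈ partSpace σ, v ⬝ᵥ x = w ⬝ᵥ x) : U = V := by
  obtain ⟨x, hx, hx0, hx1, hx2⟩ := h.exists_dual hm
  rcases h.exists_eq U hU with rfl | ⟨l, z, hz, rfl⟩ <;>
    rcases h.exists_eq V hV with rfl | ⟨l', z', hz', rfl⟩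
  · rfl
  · obtain ⟨w, hw, rfl⟩ := hw
    have := hvw _ (hx l')
    simp only [hx0 l' v hv, hx1 l' z' hz' w hw] at this
    exact (ne_zero_of_pow_eq_one hm hz' this.symm).elim
  · obtain ⟨v, hv, rfl⟩ := hv
    have := hvw _ (hx l)
    simp only [hx0 l w hw, hx1 l z hz v hv] at this
    exact (ne_zero_of_pow_eq_one hm hz this).elim
  · obtain ⟨v, hv, rfl⟩ := hv
    obtain ⟨w, hw, rfl⟩ := hw
    have := hvw _ (hx l)
    by_cases hl : l' = l
    · subst hl
      simp only [hx1 l' z hz v hv, hx1 l' z' hz' w hw] at this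
      rw [this]
    · simp only [hx1 l z hz v hv, hx2 l' l z' hl hz' w hw] at this
      exact (ne_zero_of_pow_eq_one hm hz this).elim

theorem block_eq (hm : 0 < m) (h : ColoredData σ k S₀ T) {U : Set (Fin n → ℂ)}
    (hU : U ∈ σ.parts) {v : Fin n → ℂ} (hv : v ∈ U) : block m (partSpace σ) v = U := by
  ext w
  constructor
  · rintro ⟨hw, hwv⟩
    obtain ⟨V, hV, hwV⟩ := σ.exists_part_mem hw
    exact h.eq_of_agree hm hV hU hwV hv hwv ▸ hwV
  · exact fun hw => ⟨σ.le hU hw, fun x hx => hx U hU w hw v hv⟩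

theorem partitionOf_partSpace (hm : 0 < m) (h : ColoredData σ k S₀ T) :
    partitionOf m (partSpace σ) = σ := by
  refine Finpartition.ext (Finset.ext fun U => ?_)
  rw [mem_partitionOf]
  constructor
  · rintro ⟨v, hv, rfl⟩
    obtain ⟨V, hV, hvV⟩ := σ.exists_part_mem hv
    rwa [h.block_eq hm hV hvV]
  · intro hU
    obtain ⟨v, hv⟩ := Set.nonempty_iff_ne_empty.2 (σ.ne_bot hU)
    exact ⟨v, σ.le hU hv, h.block_eq hm hU hv⟩

/-- Evaluation at one representative of each `T l` is an isomorphism onto `ℂ^k`. It is injective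
because every element of `[n^m]` lies in `S₀` or in a multiple of some `T l`, and surjective because
the dual vectors map to the standard basis. -/
theorem finrank_partSpace (hm : 0 < m) (h : ColoredData σ k S₀ T) :
    Module.finrank ℂ (partSpace σ) = k := by
  obtain ⟨x, hx, hx0, hx1, hx2⟩ := h.exists_dual hm
  choose t ht using fun l => Set.nonempty_iff_ne_empty.2 (σ.ne_bot (h.mem_parts l))
  let φ : partSpace σ →ₗ[ℂ] Fin k → ℂ :=
    LinearMap.pi fun l => (dotProductBilin ℂ ℂ (t l)).comp (partSpace σ).subtype
  have hφ : ∀ y l, φ y l = t l ⬝ᵥ (y : Fin n → ℂ) := fun y l => rfl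
  have hbij : Function.Bijective φ := by
    constructor
    · rw [← LinearMap.ker_eq_bot, LinearMap.ker_eq_bot']
      intro y hy
      have hall : ∀ v ∈ coloredSet m n, v ⬝ᵥ (y : Fin n → ℂ) = 0 := by
        intro v hv
        obtain ⟨U, hU, hvU⟩ := σ.exists_part_mem hv
        rcases h.exists_eq U hU with rfl | ⟨l, z, hz, rfl⟩
        · rw [y.2 U hU v hvU 0 h.zero_mem, zero_dotProduct]
        · obtain ⟨w, hw, rfl⟩ := hvU
          have h1 := congrFun hy l
          rw [hφ, y.2 _ (h.mem_parts l) (t l) (ht l) w hw, Pi.zero_apply] at h1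
          simp only [smul_dotProduct, h1, smul_zero]
      ext i
      simpa using hall _ (single_mem_coloredSet hm i (one_pow m))
    · intro c
      refine ⟨∑ l, c l • ⟨x l, hx l⟩, funext fun l => ?_⟩
      rw [map_sum, Finset.sum_apply, Finset.sum_eq_single l]
      · have := hx1 l 1 (one_pow m) _ (ht l)
        rw [one_smul] at this
        rw [map_smul, Pi.smul_apply, hφ, this, smul_eq_mul, mul_one]
      · intro l' _ hl
        have := hx2 l l' 1 hl.symm (one_pow m) _ (ht l)
        rw [one_smul] at this
        rw [map_smul, Pi.smul_apply, hφ, this, smul_zero]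
      · simp
  rw [(LinearEquiv.ofBijective φ hbij).finrank_eq, Module.finrank_fin_fun]

end ColoredData

/-! ### Every subspace yields a colored partition -/

/-- The partition of `[n^m]` defined by a subspace is colored. -/
theorem isColoredPartition_partitionOf (hm : 0 < m) (W : Submodule ℂ (Fin n → ℂ)) :
    IsColoredPartition (partitionOf m W) := by
  classical
  have hprim := Complex.isPrimitiveRoot_exp m hm.ne'
  set ζ : ℂ := Complex.exp (2 * Real.pi * Complex.I / m) with hζ
  have hζm : ∀ c : ℕ, (ζ ^ c) ^ m = 1 := fun c => by
    rw [← pow_mul, mul_comm, pow_mul, hprim.pow_eq_one, one_pow]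
  have : NeZero m := ⟨hm.ne'⟩
  -- The bases outside the zero block. Two of them are equivalent when their coordinates are
  -- proportional on `W` by a factor in `μ_m`, and each class gives one `m`-tuple.
  let N : Type := {i : Fin n // ∃ x ∈ W, x i ≠ 0}
  let s : Setoid N :=
    { r := fun i j => ∃ z : ℂ, z ^ m = 1 ∧ ∀ x ∈ W, x i.1 = z * x j.1
      iseqv :=
        { refl := fun i => ⟨1, one_pow m, fun x _ => (one_mul _).symm⟩
          symm := by
            rintro i j ⟨z, hz, h⟩
            refine ⟨z⁻¹, by rw [inv_pow, hz, inv_one], fun x hx => ?_⟩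
            rw [h x hx, inv_mul_cancel_left₀ (ne_zero_of_pow_eq_one hm hz)]
          trans := by
            rintro i j l ⟨z, hz, h⟩ ⟨u, hu, h'⟩
            refine ⟨z * u, by rw [mul_pow, hz, hu, one_mul], fun x hx => ?_⟩
            rw [h x hx, h' x hx, mul_assoc] } }
  let e : Fin (Fintype.card (Quotient s)) ≃ Quotient s := (Fintype.equivFin _).symm
  let r : Fin (Fintype.card (Quotient s)) → N := fun l => (e l).out
  have hmem : ∀ (i : Fin n) (c : ℕ), (Pi.single i (ζ ^ c) : Fin n → ℂ) ∈ coloredSet m n :=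
    fun i c => single_mem_coloredSet hm i (hζm c)
  have hne : ∀ c : ℕ, ζ ^ c ≠ 0 := fun c => ne_zero_of_pow_eq_one hm (hζm c)
  have hinj : Function.Injective (fun q : Fin (Fintype.card (Quotient s)) × Fin m =>
      block m W (Pi.single (r q.1).1 (ζ ^ (q.2 : ℕ)))) := by
    rintro ⟨l, j⟩ ⟨l', j'⟩ h
    have h1 := (block_eq_iff (hmem _ _)).1 h
    simp only [single_dotProduct] at h1
    have hl : l = l' := by
      refine e.injective (Quotient.out_equiv_out.1 ?_)
      refine ⟨(ζ ^ (j : ℕ))⁻¹ * ζ ^ (j' : ℕ), ?_, fun x hx => ?_⟩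
      · rw [mul_pow, inv_pow, hζm, hζm, inv_one, one_mul]
      · rw [mul_assoc, ← h1 x hx, inv_mul_cancel_left₀ (hne _)]
    subst hl
    -- A vector of `W` with nonzero coordinate at the representative distinguishes its `m` colors.
    obtain ⟨x, hx, hxr⟩ := (r l).2
    have hj : j = j' :=
      Fin.ext (hprim.pow_inj j.2 j'.2 (mul_right_cancel₀ hxr (h1 x hx)))
    rw [hj]
  refine ⟨_, block m W 0, fun l j => block m W (Pi.single (r l).1 (ζ ^ (j : ℕ))), hinj,
    ?_, ?_, ⟨mem_block_self zero_mem_coloredSet, ?_⟩, fun l => ⟨?_, ?_⟩⟩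
  · intro l j h
    have h1 := (block_eq_iff (hmem _ _)).1 h
    obtain ⟨x, hx, hxr⟩ := (r l).2
    have h2 := h1 x hx
    rw [single_dotProduct, zero_dotProduct] at h2
    exact mul_ne_zero (hne _) hxr h2
  · intro T
    rw [mem_partitionOf]
    constructor
    · rintro ⟨v, hv, rfl⟩
      rcases (mem_coloredSet hm).1 hv with rfl | ⟨i, z, hz, rfl⟩
      · exact Or.inl rfl
      · by_cases hi : ∃ x ∈ W, x i ≠ 0
        · right
          obtain ⟨u, hu, h⟩ : s.r ⟨i, hi⟩ (r (e.symm ⟦⟨i, hi⟩⟧)) := by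
            simp only [r, Equiv.apply_symm_apply]
            exact s.symm (Quotient.mk_out (s := s) ⟨i, hi⟩)
          obtain ⟨c, hc, hcz⟩ := hprim.eq_pow_of_pow_eq_one
            (show (z * u) ^ m = 1 by rw [mul_pow, hz, hu, one_mul])
          refine ⟨e.symm ⟦⟨i, hi⟩⟧, ⟨c, hc⟩, (block_eq_iff hv).2 fun x hx => ?_⟩
          rw [single_dotProduct, single_dotProduct, hcz, mul_assoc, ← h x hx]
        · left
          push Not at hi
          refine (block_eq_iff hv).2 fun x hx => ?_
          rw [single_dotProduct, zero_dotProduct, hi x hx, mul_zero]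
    · rintro (rfl | ⟨l, j, rfl⟩)
      · exact ⟨0, zero_mem_coloredSet, rfl⟩
      · exact ⟨_, hmem _ _, rfl⟩
  · rintro i ⟨c, -, hc⟩ d -
    refine ⟨hmem i d, fun x hx => ?_⟩
    have h2 := hc.2 x hx
    rw [colored, single_dotProduct, zero_dotProduct] at h2
    have h3 : x i = 0 := (mul_eq_zero.1 h2).resolve_left (hne c)
    rw [colored, single_dotProduct, zero_dotProduct, h3, mul_zero]
  · exact fun j j' h => (Prod.ext_iff.1 (@hinj (l, j) (l, j') h)).2
  · intro j j'
    have hz : (ζ ^ (j : ℕ) * (ζ ^ (j' : ℕ))⁻¹) ^ m = 1 := by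
      rw [mul_pow, inv_pow, hζm, hζm, inv_one, one_mul]
    have hz0 := ne_zero_of_pow_eq_one hm hz
    refine ⟨_, hz, Set.ext fun v => ⟨fun hv => ?_, ?_⟩⟩
    · refine ⟨(ζ ^ (j : ℕ) * (ζ ^ (j' : ℕ))⁻¹)⁻¹ • v,
        ⟨smul_mem_coloredSet hm (by rw [inv_pow, hz, inv_one]) hv.1, fun x hx => ?_⟩,
        smul_inv_smul₀ hz0 v⟩
      rw [smul_dotProduct, hv.2 x hx, single_dotProduct, single_dotProduct, smul_eq_mul]
      have := hne j
      have := hne j'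
      field_simp
    · rintro ⟨w, hw, rfl⟩
      refine ⟨smul_mem_coloredSet hm hz hw.1, fun x hx => ?_⟩
      rw [smul_dotProduct, hw.2 x hx, single_dotProduct, single_dotProduct, smul_eq_mul]
      have := hne j'
      field_simp

theorem card_parts_partitionOf (hm : 0 < m) {W : Submodule ℂ (Fin n → ℂ)}
    (hW : IsDotClosed m W) :
    (partitionOf m W).parts.card = Module.finrank ℂ W * m + 1 := by
  obtain ⟨k, S₀, T, h⟩ := (isColoredPartition_partitionOf hm W).exists_data hm
  have hk := h.finrank_partSpace hm
  rw [partSpace_partitionOf hW] at hk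
  rw [h.card_parts, hk]

end Partition

/-! ### Intersection lattices as posets of colored partitions -/

section Isomorphism

variable {m n : ℕ}

/-- If the intersections of members of `A` are the subspaces cut out by equations between elements
of `[n^m]` whose partitions satisfy `P`, then `L(A)` is the poset of colored partitions that
satisfy `P`. -/
theorem intersectionLattice_orderIso (hm : 0 < m) {A : Set (Submodule ℂ (Fin n → ℂ))}
    (hA : ∀ H ∈ A, Module.finrank ℂ H + 1 = n) {P : Finpartition (coloredSet m n) → Prop}
    (hP : ∀ σ, P σ → IsColoredPartition σ)
    (h : ∀ W, (∃ B ⊆ A, W = sInf B) ↔ IsDotClosed m W ∧ P (partitionOf m W)) :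
    Nonempty (IntersectionLattice A ≃o {σ // P σ}) ∧
      ∀ k : ℕ, whitneySecond (IntersectionLattice A) ((n : ℤ) - k) =
        Nat.card {σ : {σ // P σ} // σ.1.parts.card = k * m + 1} := by
  have hx : ∀ x : IntersectionLattice A, IsDotClosed m x.space ∧ P (partitionOf m x.space) :=
    fun x => (h _).1 (OrderDual.ofDual x).2
  let f : IntersectionLattice A ↪o {σ // P σ} := OrderEmbedding.ofMapLEIff
    (fun x => ⟨partitionOf m x.space, (hx x).2⟩) fun x y => partitionOf_le_iff (hx x).1
  have hsurj : Function.Surjective f := by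
    rintro ⟨σ, hσ⟩
    obtain ⟨k, S₀, T, hd⟩ := (hP σ hσ).exists_data hm
    have heq := hd.partitionOf_partSpace hm
    refine ⟨OrderDual.toDual ⟨partSpace σ, (h _).2 ⟨isDotClosed_partSpace σ, heq.symm ▸ hσ⟩⟩, ?_⟩
    exact Subtype.ext heq
  let e : IntersectionLattice A ≃o {σ // P σ} := RelIso.ofSurjective f hsurj
  refine ⟨⟨e⟩, fun k => ?_⟩
  rw [IntersectionLattice.whitneySecond_eq hA]
  refine Nat.card_congr (e.toEquiv.subtypeEquiv fun x => ?_)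
  change _ ↔ (partitionOf m x.space).parts.card = k * m + 1
  rw [card_parts_partitionOf hm (hx x).1]
  simp [hm.ne']

theorem isDotClosed_sInf {B : Set (Submodule ℂ (Fin n → ℂ))}
    (hB : ∀ H ∈ B, ∃ v ∈ coloredSet m n, ∃ w ∈ coloredSet m n, H = dotEqLocus v w) :
    IsDotClosed m (sInf B) := by
  intro y hy
  rw [Submodule.mem_sInf]
  intro H hH
  obtain ⟨v, hv, w, hw, rfl⟩ := hB H hH
  refine mem_dotEqLocus.2 (hy v hv w hw fun x hx => mem_dotEqLocus.1 ?_)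
  exact (Submodule.mem_sInf.1 hx) _ hH

/-- To satisfy the equations between elements of `[n^m]` that hold on `W` it is enough to satisfy
those of the forms `x_i = 0` and `x_i = ζ x_j` with `i ≠ j`. -/
theorem dotProduct_eq_of_coordinates (hm : 0 < m) {W : Submodule ℂ (Fin n → ℂ)} {y : Fin n → ℂ}
    (h0 : ∀ i, (∀ x ∈ W, x i = 0) → y i = 0)
    (h1 : ∀ i j (z : ℂ), i ≠ j → z ^ m = 1 → (∀ x ∈ W, x i = z * x j) → y i = z * y j)
    {v w : Fin n → ℂ} (hv : v ∈ coloredSet m n) (hw : w ∈ coloredSet m n)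
    (hvw : ∀ x ∈ W, v ⬝ᵥ x = w ⬝ᵥ x) : v ⬝ᵥ y = w ⬝ᵥ y := by
  rcases (mem_coloredSet hm).1 hv with rfl | ⟨i, z, hz, rfl⟩ <;>
    rcases (mem_coloredSet hm).1 hw with rfl | ⟨j, u, hu, rfl⟩ <;>
    simp only [single_dotProduct, zero_dotProduct] at hvw ⊢
  · have hu0 := ne_zero_of_pow_eq_one hm hu
    rw [h0 j fun x hx => (mul_eq_zero.1 (hvw x hx).symm).resolve_left hu0, mul_zero]
  · have hz0 := ne_zero_of_pow_eq_one hm hz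
    rw [h0 i fun x hx => (mul_eq_zero.1 (hvw x hx)).resolve_left hz0, mul_zero]
  · have hz0 := ne_zero_of_pow_eq_one hm hz
    by_cases hij : i = j
    · subst hij
      -- Two different colors of one base agree on `W` only if that coordinate vanishes there.
      by_cases hzu : z = u
      · rw [hzu]
      · have : y i = 0 := h0 i fun x hx => by
          have := hvw x hx
          rw [← sub_eq_zero, ← sub_mul] at this
          exact (mul_eq_zero.1 this).resolve_left (sub_ne_zero.2 hzu)
        rw [this, mul_zero, mul_zero]
    · rw [h1 i j (z⁻¹ * u) hij (by rw [mul_pow, inv_pow, hz, hu, inv_one, one_mul])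
        fun x hx => by rw [mul_assoc, ← hvw x hx, inv_mul_cancel_left₀ hz0], mul_assoc,
        mul_inv_cancel_left₀ hz0]

/-! ### Intersections of reflecting hyperplanes, for `p < m` and for `p = m` -/

theorem exists_dotEqLocus_of_mem_reflectionArrangement (hm : 0 < m) {p : ℕ}
    {H : Submodule ℂ (Fin n → ℂ)} (hH : H ∈ reflectionArrangement (groupG m p n)) :
    ∃ v ∈ coloredSet m n, ∃ w ∈ coloredSet m n, H = dotEqLocus v w := by
  rcases reflectionArrangement_groupG_subset hH with ⟨i, j, -, z, hz, rfl⟩ | ⟨-, i, rfl⟩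
  · exact ⟨_, single_mem_coloredSet hm i (one_pow m), _, single_mem_coloredSet hm j hz, rfl⟩
  · exact ⟨_, single_mem_coloredSet hm i (one_pow m), _, zero_mem_coloredSet, rfl⟩

theorem finrank_of_mem_reflectionArrangement {G : Subgroup (GL (Fin n) ℂ)} :
    ∀ H ∈ reflectionArrangement G, Module.finrank ℂ H + 1 = n := by
  rintro _ ⟨g, -, hg, rfl⟩
  exact hg.2

/-- A subspace `W` is an intersection of members of the arrangement of `G(m, p, n)` if equations
`x_i = 0` on `W` hold on every subspace cut out by the members that contain `W`. -/
theorem exists_eq_sInf_reflectionArrangement (hm : 0 < m) (p : ℕ) {W : Submodule ℂ (Fin n → ℂ)}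
    (hW : IsDotClosed m W)
    (h0 : ∀ y ∈ sInf {H ∈ reflectionArrangement (groupG m p n) | W ≤ H},
      ∀ i, (∀ x ∈ W, x i = 0) → y i = 0) :
    ∃ B ⊆ reflectionArrangement (groupG m p n), W = sInf B := by
  refine ⟨{H ∈ reflectionArrangement (groupG m p n) | W ≤ H}, fun H hH => hH.1,
    le_antisymm (le_sInf fun H hH => hH.2) fun y hy => hW y fun v hv w hw hvw => ?_⟩
  refine dotProduct_eq_of_coordinates hm (h0 y hy) (fun i j z hij hz h => ?_) hv hw hvw
  have := Submodule.mem_sInf.1 hy _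
    ⟨dotEqLocus_single_mem_reflectionArrangement m p hm hij hz, fun x hx => ?_⟩
  · simpa [mem_dotEqLocus] using this
  · simpa [mem_dotEqLocus] using h x hx

theorem exists_eq_sInf_iff_of_lt (hm : 0 < m) {p : ℕ} (hp : 0 < p) (hpm : p ∣ m) (hlt : p < m)
    (W : Submodule ℂ (Fin n → ℂ)) :
    (∃ B ⊆ reflectionArrangement (groupG m p n), W = sInf B) ↔ IsDotClosed m W := by
  constructor
  · rintro ⟨B, hB, rfl⟩
    exact isDotClosed_sInf fun H hH => exists_dotEqLocus_of_mem_reflectionArrangement hm (hB hH)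
  · refine fun hW => exists_eq_sInf_reflectionArrangement hm p hW fun y hy i hi => ?_
    have := Submodule.mem_sInf.1 hy _
      ⟨dotEqLocus_zero_mem_reflectionArrangement hm hp hpm hlt i, fun x hx => ?_⟩
    · simpa [mem_dotEqLocus] using this
    · simpa [mem_dotEqLocus] using hi x hx

/-- The zero block of the partition of `W` has a single base `i` iff `x_i` is the only coordinate
that vanishes on `W`. -/
theorem singleBase_mem_partitionOf_iff (hm : 0 < m) (W : Submodule ℂ (Fin n → ℂ)) (i : Fin n) :
    {0} ∪ {v | ∃ c < m, v = colored m i c} ∈ (partitionOf m W).parts ↔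
      ∀ j, (∀ x ∈ W, x j = 0) ↔ j = i := by
  have hcol : ∀ j c, colored m (n := n) j c ≠ 0 := fun j c h => by
    have := congrFun h j
    simp [colored] at this
  rw [mem_partitionOf]
  constructor
  · rintro ⟨v, hv, h⟩ j
    have h0 : (0 : Fin n → ℂ) ∈ block m W v := h ▸ Or.inl rfl
    have hb : block m W v = block m W 0 := (block_eq_iff hv).2 fun x hx => (h0.2 x hx).symm
    rw [hb] at h
    have key : (∀ x ∈ W, x j = 0) ↔ colored m j 0 ∈ block m W 0 := by
      constructor
      · exact fun hj => ⟨Or.inr ⟨j, 0, hm, rfl⟩, fun x hx => by simp [colored, hj x hx]⟩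
      · exact fun hj x hx => by simpa [colored] using hj.2 x hx
    rw [key, h]
    constructor
    · rintro (h1 | ⟨c, -, h1⟩)
      · exact (hcol _ _ h1).elim
      · by_contra hji
        have := congrFun h1 j
        simp [colored, hji] at this
    · rintro rfl
      exact Or.inr ⟨0, hm, rfl⟩
  · intro h
    refine ⟨0, zero_mem_coloredSet, Set.ext fun v => ⟨?_, ?_⟩⟩
    · rintro ⟨hv | ⟨j, c, hc, rfl⟩, hvW⟩
      · exact Or.inl hv
      · have : j = i := (h j).1 fun x hx => by simpa [colored] using hvW x hx
        subst this
        exact Or.inr ⟨c, hc, rfl⟩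
    · rintro (hv | ⟨c, hc, rfl⟩)
      · rw [Set.mem_singleton_iff.1 hv]
        exact mem_block_self zero_mem_coloredSet
      · exact ⟨Or.inr ⟨i, c, hc, rfl⟩, fun x hx => by simp [colored, (h i).2 rfl x hx]⟩

/-- Suppose `x_i` is the only coordinate vanishing on the intersection. No hyperplane `x_a = z x_b`
of `B` involves `i`, since otherwise the other coordinate would vanish as well. So `e_i` lies in the
intersection, contradicting `x_i = 0`. -/
theorem noSingleBaseZeroBlock_partitionOf_sInf (hm : 0 < m) {B : Set (Submodule ℂ (Fin n → ℂ))}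
    (hB : B ⊆ reflectionArrangement (groupG m m n)) :
    NoSingleBaseZeroBlock (partitionOf m (sInf B)) := by
  intro i hi
  rw [singleBase_mem_partitionOf_iff hm] at hi
  have hmem : (Pi.single i 1 : Fin n → ℂ) ∈ sInf B := by
    refine Submodule.mem_sInf.2 fun H hH => ?_
    rcases reflectionArrangement_groupG_subset (hB hH) with ⟨a, b, hab, z, hz, rfl⟩ | ⟨h, -⟩
    · have hz0 := ne_zero_of_pow_eq_one hm hz
      have hx : ∀ x ∈ sInf B, x a = z * x b := fun x hx => by
        simpa [mem_dotEqLocus] using Submodule.mem_sInf.1 hx _ hH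
      have ha : a ≠ i := by
        rintro rfl
        refine hab.symm ((hi b).1 fun x hxB => ?_)
        have := hx x hxB
        rw [(hi a).2 rfl x hxB] at this
        exact (mul_eq_zero.1 this.symm).resolve_left hz0
      have hb : b ≠ i := by
        rintro rfl
        refine hab ((hi a).1 fun x hxB => ?_)
        rw [hx x hxB, (hi b).2 rfl x hxB, mul_zero]
      simp [mem_dotEqLocus, ha, hb]
    · exact (h (Nat.div_self hm)).elim
  have := (hi i).2 rfl _ hmem
  simp at this

theorem exists_eq_sInf_iff_self (hm : 0 < m) (hmn : ¬ (m = 1 ∧ 2 ≤ n))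
    (W : Submodule ℂ (Fin n → ℂ)) :
    (∃ B ⊆ reflectionArrangement (groupG m m n), W = sInf B) ↔
      IsDotClosed m W ∧ NoSingleBaseZeroBlock (partitionOf m W) := by
  constructor
  · rintro ⟨B, hB, rfl⟩
    exact ⟨isDotClosed_sInf fun H hH => exists_dotEqLocus_of_mem_reflectionArrangement hm (hB hH),
      noSingleBaseZeroBlock_partitionOf_sInf hm hB⟩
  · rintro ⟨hW, hNo⟩
    refine exists_eq_sInf_reflectionArrangement hm m hW fun y hy i hi => ?_
    have hj : ∃ j, (∀ x ∈ W, x j = 0) ∧ j ≠ i := by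
      by_contra! hc
      exact hNo i ((singleBase_mem_partitionOf_iff hm W i).2 fun j =>
        ⟨hc j, fun h => h ▸ hi⟩)
    obtain ⟨j, hj, hji⟩ := hj
    -- Two distinct indices force `2 ≤ n`, so the excluded case rules out `m = 1`; two different
    -- scalars `z` are then available in `y i = z * y j`, and both coordinates vanish.
    have hm1 : 1 < m := by
      by_contra! h1
      have hi2 := i.2
      have hj2 := j.2
      have : (j : ℕ) ≠ i := fun h => hji (Fin.ext h)
      exact hmn ⟨by omega, by omega⟩
    have hprim := Complex.isPrimitiveRoot_exp m hm.ne'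
    have hy' : ∀ z : ℂ, z ^ m = 1 → y i = z * y j := by
      intro z hz
      have := Submodule.mem_sInf.1 hy _
        ⟨dotEqLocus_single_mem_reflectionArrangement m m hm hji.symm hz, fun x hx => ?_⟩
      · simpa [mem_dotEqLocus] using this
      · simp [mem_dotEqLocus, hi x hx, hj x hx]
    have h1 := hy' 1 (one_pow m)
    have h2 := hy' _ hprim.pow_eq_one
    rw [h1, ← sub_eq_zero, ← sub_mul] at h2
    rw [h1, (mul_eq_zero.1 h2).resolve_left (sub_ne_zero.2 (hprim.ne_one hm1).symm), mul_zero]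

end Isomorphism

end

theorem mainTheorem1 (m n : ℕ) (hm : 0 < m) (hn : 0 < n) :
    (∀ p : ℕ, 0 < p → p ∣ m → p < m →
      Nonempty (ReflectionLattice (groupG m p n) ≃o ColoredPartitions m n) ∧
      ∀ k : ℕ, stirlingSecondGroup (groupG m p n) k = stirlingSecondColored m n k) ∧
    (¬ (m = 1 ∧ 2 ≤ n) →
      Nonempty (ReflectionLattice (groupG m m n) ≃o ReducedColoredPartitions m n) ∧
      ∀ k : ℕ, stirlingSecondGroup (groupG m m n) k = stirlingSecondReducedColored m n k) := by
  refine ⟨fun p hp hpm hlt => ?_, fun hmn => ?_⟩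
  · exact intersectionLattice_orderIso hm finrank_of_mem_reflectionArrangement (fun _ h => h)
      fun W => (exists_eq_sInf_iff_of_lt hm hp hpm hlt W).trans
        (and_iff_left (isColoredPartition_partitionOf hm W)).symm
  · exact intersectionLattice_orderIso hm finrank_of_mem_reflectionArrangement (fun _ h => h.1)
      fun W => (exists_eq_sInf_iff_self hm hmn W).trans
        (and_congr_right' (and_iff_right (isColoredPartition_partitionOf hm W)).symm)
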